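/- Let $\mathbb K$ be an arbitrary field (of any characteristic, not necessarily algebraically closed), let $\lambda\in\mathbb K$, $\ell\ge 1$, and let $k_1,\dots,k_\ell\ge 1$ and $r_1>r_2>\dots>r_\ell\ge 1$ be integers. Let $J_{\lambda,r}$ denote the $r\times r$ Jordan block with eigenvalue $\lambda$ (ones on the superdiagonal), and let $$J_\lambda=\bigoplus_{i=1}^{\ell}k_iJ_{\lambda,r_i},\qquad k_iJ_{\lambda,r_i}=\underbrace{J_{\lambda,r_i}\oplus\cdots\oplus J_{\lambda,r_i}}_{k_i}.$$ Index the rows of $J_\lambda$ by the set $\Lambda$ of triples $(i_1,i_2,i_3)$ with $1\le i_1\le\ell$, $1\le i_2\le k_{i_1}$, $1\le i_3\le r_{i_1}$, where $(i_1,i_2,i_3)$ is the $i_3$-th row of the $i_2$-th block of size $r_{i_1}$. Let $R=\mathbb K[x(\boldsymbol i)\mid \boldsymbol i\in\Lambda]$, let $\boldsymbol x$ be the column vector of the variables, and let $I_\lambda\subseteq R$ be the ideal generated by the $2\times 2$ minors of the two-column matrix $(J_\lambda\boldsymbol x\mid\boldsymbol x)$. For $j\in\{1,\dots,\ell\}$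 put $$\Lambda_j=\{\boldsymbol i\in\Lambda\mid i_1\le j\},\quad \Lambda_{j,1}=\{\boldsymbol i\in\Lambda_j\mid i_3\ge r_j+1\},\quad \Lambda_{j,2}=\Lambda\setminus\Lambda_j,\quad \Theta_j=\{\boldsymbol i\in\Lambda_j\mid i_3=1\},$$ $$I_j=\langle x(\boldsymbol i)\mid\boldsymbol i\in\Lambda_{j,1}\cup\Lambda_{j,2}\rangle,\qquad \mathfrak q_{\lambda,j}=I_\lambda+I_j,\qquad \mathfrak h_j=\langle x(\boldsymbol i)\mid\boldsymbol i\in\Lambda\setminus\Theta_j\rangle .$$ Then $$I_\lambda=\bigcap_{j=1}^{\ell}\mathfrak q_{\lambda,j},$$ and for every $j\in\{1,\dots,\ell\}$ the ideal $\mathfrak q_{\lambda,j}$ is primary with radical $\sqrt{\mathfrak q_{\lambda,j}}=\mathfrak h_j$. In particular, the displayed intersection is a primary decomposition of $I_\lambda$. -/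

import Mathlib

namespace Eigenscheme

open MvPolynomial

section Ideal

/-- The augmented matrix `(A x | x)`, where `x` is the column vector of the variables of the
polynomial ring `K[x_i | i ∈ n]`. -/
noncomputable def augmented {K n : Type*} [Field K] [Fintype n] (A : Matrix n n K) :
    Matrix n (Fin 2) (MvPolynomial n K) :=
  Matrix.of fun i => ![((A.map C).mulVec (X : n → MvPolynomial n K)) i, X i]

/-- The ideal `I_A` generated by the `2 × 2` minors of `(A x | x)`. The rows of a minor run over
all ordered pairs `(i, j)`; the pairs with `i = j` contribute the generator `0`, and the pairs
`(i, j)` and `(j, i)` give the same minor up to sign. -/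
noncomputable def minorIdeal {K n : Type*} [Field K] [Fintype n] (A : Matrix n n K) :
    Ideal (MvPolynomial n K) :=
  Ideal.span {f | ∃ i j : n, f = ((augmented A).submatrix ![i, j] id).det}

end Ideal

section Jordan

/-- The Jordan block of size `r` with eigenvalue `c` (ones on the superdiagonal). -/
def jordanBlock {K : Type*} [Field K] (c : K) (r : ℕ) : Matrix (Fin r) (Fin r) K :=
  Matrix.of fun a b => if a = b then c else if (a : ℕ) + 1 = (b : ℕ) then 1 else 0

/-- The index set `Λ` of rows and variables: `⟨⟨i₁, i₂⟩, i₃⟩` is the row `i₃` of the `i₂`-th copy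
of the Jordan block of size `r i₁`. All indices are counted from `0`. -/
abbrev Idx {l : ℕ} (k r : Fin l → ℕ) : Type :=
  (p : (i : Fin l) × Fin (k i)) × Fin (r p.1)

/-- The Jordan matrix with the single eigenvalue `c` that has `k i` blocks of size `r i`. -/
def jordanMatrix {K : Type*} [Field K] (c : K) {l : ℕ} (k r : Fin l → ℕ) :
    Matrix (Idx k r) (Idx k r) K :=
  Matrix.blockDiagonal' fun p : (i : Fin l) × Fin (k i) => jordanBlock c (r p.1)

/-- `Λ_j`: the indices belonging to blocks of one of the sizes `r 0, …, r j`. -/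
def lam {l : ℕ} (k r : Fin l → ℕ) (j : Fin l) : Set (Idx k r) :=
  {a | a.1.1 ≤ j}

/-- `Λ_{j,1}`: the indices in `Λ_j` whose row number within the block, counted from `1`, is at
least `r j + 1`. -/
def lam₁ {l : ℕ} (k r : Fin l → ℕ) (j : Fin l) : Set (Idx k r) :=
  {a | a ∈ lam k r j ∧ r j + 1 ≤ (a.2 : ℕ) + 1}

/-- `Λ_{j,2} = Λ \ Λ_j`. -/
def lam₂ {l : ℕ} (k r : Fin l → ℕ) (j : Fin l) : Set (Idx k r) :=
  (lam k r j)ᶜ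

/-- `Θ_j`: the indices of the first rows of the blocks of sizes `r 0, …, r j`. -/
def theta {l : ℕ} (k r : Fin l → ℕ) (j : Fin l) : Set (Idx k r) :=
  {a | a.1.1 ≤ j ∧ (a.2 : ℕ) = 0}

/-- The ideal generated by the variables with index in `S`. -/
noncomputable def varIdeal (K : Type*) [Field K] {n : Type*} (S : Set n) :
    Ideal (MvPolynomial n K) :=
  Ideal.span ((X : n → MvPolynomial n K) '' S)

/-- `I_j = I_{j,1} + I_{j,2}`. -/
noncomputable def idealI (K : Type*) [Field K] {l : ℕ} (k r : Fin l → ℕ) (j : Fin l) :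
    Ideal (MvPolynomial (Idx k r) K) :=
  varIdeal K (lam₁ k r j) + varIdeal K (lam₂ k r j)

/-- `𝔮_{c,j} = I_c + I_j`, where `I_c` is the ideal of the Jordan matrix. -/
noncomputable def idealQ {K : Type*} [Field K] (c : K) {l : ℕ} (k r : Fin l → ℕ) (j : Fin l) :
    Ideal (MvPolynomial (Idx k r) K) :=
  minorIdeal (jordanMatrix c k r) + idealI K k r j

/-- `𝔥_j`, generated by the variables with index outside `Θ_j`. -/
noncomputable def idealH (K : Type*) [Field K] {l : ℕ} (k r : Fin l → ℕ) (j : Fin l) :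
    Ideal (MvPolynomial (Idx k r) K) :=
  varIdeal K (theta k r j)ᶜ

end Jordan

end Eigenscheme

namespace Eigenscheme

open MvPolynomial

/-! The eigenvalue cancels in every minor; with x(p, a) = 0 below block p, the minors say x(p, a+1)
x(q, b) = x(p, a) x(q, b+1). Row numbers thus move freely between factors, and modulo the minors a
monomial depends only on its weight: the multiset of its blocks and its total row number d.

Let φ_j send x(p, a) to y_p ε^a for blocks of index at most j, and to 0 for the others. Each weight
with only such blocks gives its own monomial in y and ε, so the coefficients of φ_j(f) are sums of
coefficients of f over weights. Hence 𝔮_j and 𝔥_j are the preimages of (ε^{r_j}) and (ε)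
(`idealQ_eq_comap`, `idealH_eq_comap`), and primarity and radical pull back from powers of the prime
ε.

For the intersection (`iInf_idealQ_le`), take in each nonempty weight a smallest block p, of index
j. If d ≥ r_j, moving all row numbers onto p kills the monomial; otherwise φ_j(f) ∈ (ε^{r_j}) makes
the coefficient sum vanish. -/

/-- A polynomial lies in an ideal `J` as soon as its exponents can be sorted by a map `μ` such that
monomials in one fibre are congruent modulo `J`, and in each fibre the coefficients
sum to zero or the monomials lie in `J`. -/
lemma mem_of_fiberwise {K σ τ : Type*} [CommRing K] (J : Ideal (MvPolynomial σ K))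
    (μ : (σ →₀ ℕ) → τ) (f : MvPolynomial σ K) [DecidableEq τ]
    (hcongr : ∀ m n, μ m = μ n → (monomial m 1 - monomial n 1 : MvPolynomial σ K) ∈ J)
    (hsum : ∀ m ∈ f.support, (monomial m 1 : MvPolynomial σ K) ∈ J ∨
      ∑ n ∈ f.support with μ n = μ m, f.coeff n = 0) :
    f ∈ J := by
  rw [f.as_sum, ← Finset.sum_fiberwise_of_maps_to
    (fun m hm => Finset.mem_image_of_mem μ hm)]
  refine J.sum_mem fun t ht => ?_
  obtain ⟨m, hm, rfl⟩ := Finset.mem_image.1 ht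
  have hsplit : ∑ n ∈ f.support with μ n = μ m, monomial n (f.coeff n) =
      ∑ n ∈ f.support with μ n = μ m, C (f.coeff n) * (monomial n 1 - monomial m 1) +
        C (∑ n ∈ f.support with μ n = μ m, f.coeff n) * monomial m 1 := by
    rw [map_sum, Finset.sum_mul, ← Finset.sum_add_distrib]
    refine Finset.sum_congr rfl fun n _ => ?_
    rw [mul_sub, sub_add_cancel, C_mul_monomial, mul_one]
  rw [hsplit]
  refine J.add_mem (J.sum_mem fun n hn => J.mul_mem_left _ (hcongr _ _ (Finset.mem_filter.1 hn).2))
    ?_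
  rcases hsum m hm with h | h
  · exact J.mul_mem_left _ h
  · simp [h]

lemma monomial_one_eq_prod_map {K σ : Type*} [CommSemiring K] (m : σ →₀ ℕ) :
    (monomial m 1 : MvPolynomial σ K) = ((Finsupp.toMultiset m).map X).prod := by
  rw [Finsupp.toMultiset_map, Finsupp.prod_toMultiset, Finsupp.prod_mapDomain_index, monomial_eq]
  · simp
  · simp
  · intros; exact pow_add _ _ _

lemma isPrimary_span_pow_of_prime {A : Type*} [CommRing A] [IsDomain A] {p : A} (hp : Prime p)
    {n : ℕ} (hn : n ≠ 0) : (Ideal.span {p ^ n}).IsPrimary := by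
  rw [Ideal.isPrimary_iff]
  refine ⟨fun h => hp.not_isUnit ?_, fun {x y} h => ?_⟩
  · exact (isUnit_pow_iff hn).1 (Ideal.span_singleton_eq_top.1 h)
  · by_cases hy : p ∣ y
    · exact Or.inr ⟨n, Ideal.mem_span_singleton.2 (pow_dvd_pow_of_dvd hy n)⟩
    · exact Or.inl (Ideal.mem_span_singleton.2
        (hp.pow_dvd_of_dvd_mul_right n hy (Ideal.mem_span_singleton.1 h)))

lemma radical_span_pow_of_prime {A : Type*} [CommRing A] [IsDomain A] {p : A} (hp : Prime p)
    {n : ℕ} (hn : n ≠ 0) : (Ideal.span {p ^ n}).radical = Ideal.span {p} := by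
  rw [← Ideal.span_singleton_pow, Ideal.radical_pow _ hn]
  exact ((Ideal.span_singleton_prime hp.ne_zero).2 hp).radical

lemma mul_add_comm_of_shift {P A : Type*} [CommRing A] (u : P → ℕ → A)
    (hu : ∀ p q a b, u p (a + 1) * u q b = u p a * u q (b + 1)) (p q : P) (a b : ℕ) :
    u p a * u q b = u p (a + b) * u q 0 := by
  induction b generalizing a with
  | zero => rfl
  | succ b ih => rw [← hu, ih]; congr 2; omega

/-- All second indices in a product can be moved to one chosen factor. -/
lemma mul_prod_map_of_shift {P A ι : Type*} [CommRing A] (u : P → ℕ → A)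
    (hu : ∀ p q a b, u p (a + 1) * u q b = u p a * u q (b + 1)) (π : ι → P) (h : ι → ℕ)
    (q : P) (a : ℕ) (s : Multiset ι) :
    u q a * (s.map fun i => u (π i) (h i)).prod =
      u q (a + (s.map h).sum) * ((s.map π).map fun p => u p 0).prod := by
  induction s using Multiset.induction_on generalizing a with
  | empty => simp
  | cons i s ih =>
    simp only [Multiset.map_cons, Multiset.prod_cons, Multiset.sum_cons]
    rw [← mul_assoc, mul_add_comm_of_shift u hu, mul_right_comm, ih, add_assoc]
    ring

/-! ### Minors of the Jordan matrix and weights of monomials -/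

section Blocks

variable {K : Type*} [Field K] {l : ℕ} (k r : Fin l → ℕ)

/-- The variable in row `a` of the block `p`, with the value `0` below the last row. -/
noncomputable def rowVar (K : Type*) [Field K] (p : (i : Fin l) × Fin (k i)) (a : ℕ) :
    MvPolynomial (Idx k r) K :=
  if h : a < r p.1 then X ⟨p, a, h⟩ else 0

lemma rowVar_val (i : Idx k r) : rowVar k r K i.1 i.2 = X i := by
  simp [rowVar]

lemma rowVar_of_le {p : (i : Fin l) × Fin (k i)} {a : ℕ} (h : r p.1 ≤ a) :
    rowVar k r K p a = 0 := by
  simp [rowVar, h]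

lemma jordanMatrix_mulVec (c : K) (i : Idx k r) :
    (((jordanMatrix c k r).map C).mulVec X) i = C c * X i + rowVar k r K i.1 (i.2 + 1) := by
  obtain ⟨p, a⟩ := i
  simp only [Matrix.mulVec, dotProduct, jordanMatrix, Matrix.map_apply]
  rw [Fintype.sum_sigma, Finset.sum_eq_single p]
  · have hsplit : ∀ b : Fin (r p.1), C (jordanBlock c (r p.1) a b) * X ⟨p, b⟩ =
        (if a = b then C c * X ⟨p, b⟩ else 0) +
          (if (a : ℕ) + 1 = b then (X ⟨p, b⟩ : MvPolynomial (Idx k r) K) else 0) := by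
      intro b
      by_cases hab : a = b
      · subst hab; simp [jordanBlock]
      · by_cases hab' : (a : ℕ) + 1 = b <;> simp [jordanBlock, hab, hab']
    simp only [Matrix.blockDiagonal'_apply_eq, hsplit, Finset.sum_add_distrib,
      Finset.sum_ite_eq, Finset.mem_univ, if_true]
    congr 1
    by_cases h : (a : ℕ) + 1 < r p.1
    · rw [Finset.sum_eq_single ⟨a + 1, h⟩]
      · simp [rowVar, h]
      · intro b _ hb
        exact if_neg fun hab => hb (Fin.ext hab.symm)
      · simp
    · rw [rowVar_of_le k r (not_lt.1 h)]
      refine Finset.sum_eq_zero fun b _ => if_neg ?_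
      have := b.2
      omega
  · intro q _ hq
    refine Finset.sum_eq_zero fun b _ => ?_
    rw [Matrix.blockDiagonal'_apply_ne _ _ _ hq.symm]; simp
  · simp

lemma det_augmented_jordanMatrix (c : K) (i j : Idx k r) :
    ((augmented (jordanMatrix c k r)).submatrix ![i, j] id).det =
      rowVar k r K i.1 (i.2 + 1) * X j - X i * rowVar k r K j.1 (j.2 + 1) := by
  rw [Matrix.det_fin_two]
  simp only [augmented, Matrix.submatrix_apply, Matrix.of_apply, id, Matrix.cons_val_zero,
    Matrix.cons_val_one, jordanMatrix_mulVec]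
  ring

lemma shift_mem_minorIdeal (c : K) (p q : (i : Fin l) × Fin (k i)) (a b : ℕ) :
    rowVar k r K p (a + 1) * rowVar k r K q b - rowVar k r K p a * rowVar k r K q (b + 1) ∈
      minorIdeal (jordanMatrix c k r) := by
  by_cases ha : a < r p.1
  · by_cases hb : b < r q.1
    · refine Ideal.subset_span ⟨⟨p, a, ha⟩, ⟨q, b, hb⟩, ?_⟩
      rw [det_augmented_jordanMatrix]
      simp [rowVar, ha, hb]
    -- Past the last row of a block both products are zero, so no bounds on `a` and `b` are needed.
    · rw [rowVar_of_le k r (not_lt.1 hb), rowVar_of_le k r (by omega : r q.1 ≤ b + 1)]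
      simp
  · rw [rowVar_of_le k r (not_lt.1 ha), rowVar_of_le k r (by omega : r p.1 ≤ a + 1)]
    simp

/-- The multiset of blocks met by a monomial, with the sum of the row numbers. -/
noncomputable def weight (m : Idx k r →₀ ℕ) : Multiset ((i : Fin l) × Fin (k i)) × ℕ :=
  ((Finsupp.toMultiset m).map Sigma.fst, ((Finsupp.toMultiset m).map fun i => (i.2 : ℕ)).sum)

variable {k r}

lemma eq_zero_of_weight_fst {m : Idx k r →₀ ℕ} (h : (weight k r m).1 = 0) : m = 0 := by
  rw [weight, Multiset.map_eq_zero] at h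
  classical
  rw [← Finsupp.toMultiset_toFinsupp m, h, Multiset.toFinsupp_zero]

/-- Modulo the minors, a monomial is determined by its weight. -/
lemma monomial_sub_mem_minorIdeal (c : K) {q : (i : Fin l) × Fin (k i)} {m : Idx k r →₀ ℕ}
    (hq : q ∈ (weight k r m).1) :
    (monomial m 1 : MvPolynomial (Idx k r) K) - rowVar k r K q (weight k r m).2 *
      ((((weight k r m).1.erase q).map fun p => rowVar k r K p 0)).prod ∈
        minorIdeal (jordanMatrix c k r) := by
  obtain ⟨i, hi, rfl⟩ := Multiset.mem_map.1 hq
  obtain ⟨s, hs⟩ := Multiset.exists_cons_of_mem hi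
  rw [← Ideal.Quotient.eq, monomial_one_eq_prod_map]
  simp only [weight, hs, Multiset.map_cons, Multiset.prod_cons, Multiset.sum_cons,
    Multiset.erase_cons_head]
  have h := mul_prod_map_of_shift
    (fun p a => Ideal.Quotient.mk (minorIdeal (jordanMatrix c k r)) (rowVar k r K p a))
    (fun p q a b => by
      rw [← map_mul, ← map_mul, Ideal.Quotient.eq]
      exact shift_mem_minorIdeal k r c p q a b)
    (Sigma.fst : Idx k r → _) (fun i => (i.2 : ℕ)) i.1 i.2 s
  simp only [rowVar_val] at h
  rw [map_mul, map_mul, map_multiset_prod, map_multiset_prod, Multiset.map_map, Multiset.map_map]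
  exact h

lemma monomial_sub_monomial_mem_minorIdeal (c : K) {m n : Idx k r →₀ ℕ}
    (h : weight k r m = weight k r n) :
    (monomial m 1 - monomial n 1 : MvPolynomial (Idx k r) K) ∈
      minorIdeal (jordanMatrix c k r) := by
  rcases (weight k r m).1.empty_or_exists_mem with h0 | ⟨q, hq⟩
  · rw [eq_zero_of_weight_fst h0, eq_zero_of_weight_fst (h ▸ h0 : (weight k r n).1 = 0), sub_self]
    exact Ideal.zero_mem _
  · have h₁ := monomial_sub_mem_minorIdeal c hq
    have h₂ := monomial_sub_mem_minorIdeal (K := K) c (h ▸ hq : q ∈ (weight k r n).1)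
    rw [← h] at h₂
    simpa using Ideal.sub_mem _ h₁ h₂

lemma monomial_mem_of_weight (c : K) {J : Ideal (MvPolynomial (Idx k r) K)}
    (hJ : minorIdeal (jordanMatrix c k r) ≤ J) {q : (i : Fin l) × Fin (k i)} {m : Idx k r →₀ ℕ}
    (hq : q ∈ (weight k r m).1) (hv : rowVar k r K q (weight k r m).2 ∈ J) :
    (monomial m 1 : MvPolynomial (Idx k r) K) ∈ J := by
  have h := J.add_mem (hJ (monomial_sub_mem_minorIdeal c hq)) (J.mul_mem_right
    ((((weight k r m).1.erase q).map fun p => rowVar k r K p 0)).prod hv)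
  simpa using h

/-! ### The parametrization and its coefficients -/

variable (k r)

/-- The parametrization `x(p, a) ↦ y_p ε ^ a` on the blocks of index at most `j`; the variables of
all other blocks are sent to `0`. -/
noncomputable def param (K : Type*) [Field K] (j : Fin l) :
    MvPolynomial (Idx k r) K →ₐ[K] Polynomial (MvPolynomial ((i : Fin l) × Fin (k i)) K) :=
  aeval fun i => if i.1.1 ≤ j then Polynomial.C (X i.1) * Polynomial.X ^ (i.2 : ℕ) else 0

variable {k r}

lemma param_X (j : Fin l) (i : Idx k r) :
    param k r K j (X i) =
      if i.1.1 ≤ j then Polynomial.C (X i.1) * Polynomial.X ^ (i.2 : ℕ) else 0 := by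
  simp [param]

lemma param_monomial_of_le {j : Fin l} {m : Idx k r →₀ ℕ}
    (hm : ∀ p ∈ (weight k r m).1, p.1 ≤ j) (a : K) :
    param k r K j (monomial m a) = Polynomial.monomial (weight k r m).2
      (monomial (Multiset.toFinsupp (weight k r m).1) a) := by
  have key : ∀ s : Multiset (Idx k r), (∀ i ∈ s, i.1.1 ≤ j) →
      param k r K j (s.map X).prod = Polynomial.monomial (s.map fun i => (i.2 : ℕ)).sum
        (monomial (Multiset.toFinsupp (s.map Sigma.fst)) 1) := by
    intro s hs
    induction s using Multiset.induction_on with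
    | empty => simp
    | cons i s ih =>
      have hi := hs i (Multiset.mem_cons_self _ _)
      simp only [Multiset.map_cons, Multiset.prod_cons, Multiset.sum_cons, map_mul]
      rw [ih fun i' hi' => hs i' (Multiset.mem_cons_of_mem hi'), param_X, if_pos hi,
        Polynomial.C_mul_X_pow_eq_monomial, Polynomial.monomial_mul_monomial, X,
        monomial_mul, ← Multiset.singleton_add, Multiset.toFinsupp_add,
        Multiset.toFinsupp_singleton, mul_one]
  have h1 : (monomial m a : MvPolynomial (Idx k r) K) = a • monomial m 1 := by
    simp [smul_monomial]
  rw [h1, map_smul, monomial_one_eq_prod_map, key _ fun i hi =>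
    hm i.1 (Multiset.mem_map_of_mem _ hi), Polynomial.smul_monomial, smul_monomial, smul_eq_mul,
    mul_one]
  rfl

lemma param_monomial_of_not_le {j : Fin l} {m : Idx k r →₀ ℕ}
    {p : (i : Fin l) × Fin (k i)} (hp : p ∈ (weight k r m).1) (hpj : ¬ p.1 ≤ j) (a : K) :
    param k r K j (monomial m a) = 0 := by
  obtain ⟨i, hi, rfl⟩ := Multiset.mem_map.1 hp
  have h1 : (monomial m a : MvPolynomial (Idx k r) K) = a • monomial m 1 := by
    simp [smul_monomial]
  rw [h1, map_smul, monomial_one_eq_prod_map, map_multiset_prod, Multiset.prod_eq_zero, smul_zero]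
  rw [Multiset.map_map]
  exact Multiset.mem_map.2 ⟨i, hi, by simp [param_X, hpj]⟩

lemma coeff_param {j : Fin l} (f : MvPolynomial (Idx k r) K)
    {t : Multiset ((i : Fin l) × Fin (k i)) × ℕ} (ht : ∀ p ∈ t.1, p.1 ≤ j) :
    ((param k r K j f).coeff t.2).coeff (Multiset.toFinsupp t.1) =
      ∑ m ∈ f.support with weight k r m = t, f.coeff m := by
  conv_lhs => rw [f.as_sum]
  rw [map_sum, Polynomial.finsetSum_coeff, coeff_sum, Finset.sum_filter]
  refine Finset.sum_congr rfl fun m _ => ?_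
  by_cases hm : ∀ p ∈ (weight k r m).1, p.1 ≤ j
  · rw [param_monomial_of_le hm, Polynomial.coeff_monomial]
    by_cases h2 : (weight k r m).2 = t.2
    · rw [if_pos h2, coeff_monomial]
      refine if_congr ?_ rfl rfl
      rw [EmbeddingLike.apply_eq_iff_eq, Prod.ext_iff]
      exact ⟨fun h => ⟨h, h2⟩, fun h => h.1⟩
    · rw [if_neg h2, if_neg fun h => h2 (congrArg Prod.snd h), coeff_zero]
  · push Not at hm
    obtain ⟨p, hp, hpj⟩ := hm
    rw [param_monomial_of_not_le hp (not_le.2 hpj), Polynomial.coeff_zero, coeff_zero, if_neg]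
    rintro rfl
    exact absurd (ht p hp) (not_le.2 hpj)

lemma sum_coeff_eq_zero {j : Fin l} {n : ℕ} {f : MvPolynomial (Idx k r) K}
    (hf : f ∈ (Ideal.span {Polynomial.X ^ n}).comap (param k r K j))
    {t : Multiset ((i : Fin l) × Fin (k i)) × ℕ} (ht : ∀ p ∈ t.1, p.1 ≤ j) (htn : t.2 < n) :
    ∑ m ∈ f.support with weight k r m = t, f.coeff m = 0 := by
  rw [← coeff_param f ht, Polynomial.X_pow_dvd_iff.1
    (Ideal.mem_span_singleton.1 (Ideal.mem_comap.1 hf)) _ htn, coeff_zero]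

/-- The common half of both preimage descriptions: `n = r j` serves 𝔮_j and `n = 1` serves 𝔥_j. -/
lemma comap_param_le (c : K) {j : Fin l} {n : ℕ} (hn : n ≠ 0)
    {J : Ideal (MvPolynomial (Idx k r) K)} (hJ : minorIdeal (jordanMatrix c k r) ≤ J)
    (h₁ : ∀ i : Idx k r, i.1.1 ≤ j → n ≤ i.2 → X i ∈ J)
    (h₂ : ∀ i : Idx k r, ¬ i.1.1 ≤ j → X i ∈ J) :
    (Ideal.span {Polynomial.X ^ n}).comap (param k r K j) ≤ J := by
  classical
  intro f hf
  have hrow : ∀ (p : (i : Fin l) × Fin (k i)) (a : ℕ), (p.1 ≤ j → n ≤ a) →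
      rowVar k r K p a ∈ J := by
    intro p a hpa
    unfold rowVar
    split_ifs with h
    · by_cases hp : p.1 ≤ j
      · exact h₁ _ hp (hpa hp)
      · exact h₂ _ hp
    · exact J.zero_mem
  refine mem_of_fiberwise J (weight k r) f
    (fun m m' h => hJ (monomial_sub_monomial_mem_minorIdeal c h)) fun m _ => ?_
  -- Either some block of the monomial can absorb all row numbers and become a variable in `J` or
  -- zero, or the weight is visible to `param` in degree below `n`.
  by_cases hm : ∃ p ∈ (weight k r m).1, p.1 ≤ j → n ≤ (weight k r m).2
  · obtain ⟨p, hp, hpn⟩ := hm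
    exact Or.inl (monomial_mem_of_weight c hJ hp (hrow _ _ hpn))
  · push Not at hm
    refine Or.inr (sum_coeff_eq_zero hf (fun p hp => (hm p hp).1) ?_)
    rcases (weight k r m).1.empty_or_exists_mem with h0 | ⟨q, hq⟩
    · simpa [eq_zero_of_weight_fst h0, weight] using Nat.pos_of_ne_zero hn
    · exact (hm q hq).2

/-- Truncating a block is invisible modulo ε^n: blocks of index at most j have at least r_j ≥ n
rows, so ε^a is already zero where the variables stop. -/
lemma mk_param_rowVar (hr : Antitone r) {j : Fin l} {n : ℕ} (hn : n ≤ r j)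
    (p : (i : Fin l) × Fin (k i)) (a : ℕ) :
    Ideal.Quotient.mk (Ideal.span {Polynomial.X ^ n}) (param k r K j (rowVar k r K p a)) =
      Ideal.Quotient.mk (Ideal.span {Polynomial.X ^ n})
        (if p.1 ≤ j then Polynomial.C (X p) * Polynomial.X ^ a else 0) := by
  by_cases ha : a < r p.1
  · rw [rowVar, dif_pos ha, param_X]
  · rw [rowVar_of_le k r (not_lt.1 ha), map_zero, map_zero, eq_comm, Ideal.Quotient.eq_zero_iff_mem]
    split_ifs with hp
    · refine Ideal.mul_mem_left _ _ (Ideal.mem_span_singleton.2 (pow_dvd_pow _ ?_))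
      exact (hn.trans (hr hp)).trans (not_lt.1 ha)
    · exact Ideal.zero_mem _

lemma minorIdeal_le_comap_param (c : K) (hr : Antitone r) {j : Fin l} {n : ℕ} (hn : n ≤ r j) :
    minorIdeal (jordanMatrix c k r) ≤
      (Ideal.span {Polynomial.X ^ n}).comap (param k r K j) := by
  refine Ideal.span_le.2 ?_
  rintro _ ⟨i, i', rfl⟩
  rw [det_augmented_jordanMatrix, ← rowVar_val k r i, ← rowVar_val k r i', SetLike.mem_coe,
    Ideal.mem_comap, map_sub, map_mul, map_mul, ← Ideal.Quotient.eq, map_mul, map_mul]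
  simp only [mk_param_rowVar hr hn]
  rw [← map_mul, ← map_mul]
  congr 1
  split_ifs <;> ring

/-! ### The ideals 𝔮_j and 𝔥_j as preimages, and the intersection -/

lemma varIdeal_le {σ : Type*} {S : Set σ} {J : Ideal (MvPolynomial σ K)}
    (h : ∀ i ∈ S, X i ∈ J) : varIdeal K S ≤ J := by
  refine Ideal.span_le.2 ?_
  rintro _ ⟨i, hi, rfl⟩
  exact h i hi

lemma X_mem_varIdeal {σ : Type*} {S : Set σ} {i : σ} (h : i ∈ S) : X i ∈ varIdeal K S :=
  Ideal.subset_span ⟨i, h, rfl⟩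

lemma X_mem_comap_param {j : Fin l} {n : ℕ} {i : Idx k r} (h : i.1.1 ≤ j → n ≤ i.2) :
    X i ∈ (Ideal.span {Polynomial.X ^ n}).comap (param k r K j) := by
  rw [Ideal.mem_comap, param_X]
  split_ifs with hi
  · exact Ideal.mul_mem_left _ _ (Ideal.mem_span_singleton.2 (pow_dvd_pow _ (h hi)))
  · exact Ideal.zero_mem _

lemma idealQ_eq_comap (c : K) (hr : Antitone r) {j : Fin l} (hj : r j ≠ 0) :
    idealQ c k r j = (Ideal.span {Polynomial.X ^ r j}).comap (param k r K j) := by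
  refine le_antisymm (sup_le (minorIdeal_le_comap_param c hr le_rfl) (sup_le ?_ ?_))
    (comap_param_le c hj le_sup_left ?_ ?_)
  · exact varIdeal_le fun i hi => X_mem_comap_param fun _ => Nat.le_of_succ_le_succ hi.2
  · exact varIdeal_le fun i hi => X_mem_comap_param fun h => absurd h hi
  · exact fun i hi hn => Ideal.mem_sup_right
      (Ideal.mem_sup_left (X_mem_varIdeal ⟨hi, Nat.succ_le_succ hn⟩))
  · exact fun i hi => Ideal.mem_sup_right (Ideal.mem_sup_right (X_mem_varIdeal hi))

lemma minorIdeal_le_idealH (c : K) (j : Fin l) :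
    minorIdeal (jordanMatrix c k r) ≤ idealH K k r j := by
  have hrow : ∀ (p : (i : Fin l) × Fin (k i)) (a : ℕ), rowVar k r K p (a + 1) ∈ idealH K k r j := by
    intro p a
    unfold rowVar
    split_ifs
    · exact X_mem_varIdeal fun h => Nat.succ_ne_zero a h.2
    · exact Ideal.zero_mem _
  refine Ideal.span_le.2 ?_
  rintro _ ⟨i, i', rfl⟩
  rw [det_augmented_jordanMatrix]
  exact Ideal.sub_mem _ (Ideal.mul_mem_right _ _ (hrow _ _)) (Ideal.mul_mem_left _ _ (hrow _ _))

lemma idealH_eq_comap (j : Fin l) :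
    idealH K k r j = (Ideal.span {Polynomial.X}).comap (param k r K j) := by
  rw [← pow_one (Polynomial.X (R := MvPolynomial ((i : Fin l) × Fin (k i)) K))]
  refine le_antisymm (varIdeal_le fun i hi => X_mem_comap_param fun h => ?_)
    -- The eigenvalue 0 is an arbitrary choice, since it does not occur in the result.
    (comap_param_le 0 one_ne_zero (minorIdeal_le_idealH 0 j) ?_ ?_)
  · exact Nat.one_le_iff_ne_zero.2 fun h0 => hi ⟨h, h0⟩
  · exact fun i _ h1 => X_mem_varIdeal fun h => Nat.one_le_iff_ne_zero.1 h1 h.2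
  · exact fun i hi => X_mem_varIdeal fun h => hi h.1

lemma iInf_idealQ_le (c : K) (hl : 1 ≤ l) (hr : ∀ i, 1 ≤ r i) (hanti : Antitone r) :
    ⨅ j : Fin l, idealQ c k r j ≤ minorIdeal (jordanMatrix c k r) := by
  classical
  intro f hf
  have hfj : ∀ j, f ∈ (Ideal.span {Polynomial.X ^ r j}).comap (param k r K j) := fun j => by
    rw [← idealQ_eq_comap c hanti (Nat.one_le_iff_ne_zero.1 (hr j))]
    exact (Submodule.mem_iInf _).1 hf j
  refine mem_of_fiberwise _ (weight k r) f
    (fun m m' h => monomial_sub_monomial_mem_minorIdeal c h) fun m _ => ?_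
  rcases (weight k r m).1.empty_or_exists_mem with h0 | ⟨q, hq⟩
  -- The monomial 1 meets no block, so any j works; this needs at least one block size.
  · refine Or.inr (sum_coeff_eq_zero (hfj ⟨0, hl⟩) (by simp [h0]) ?_)
    simpa [eq_zero_of_weight_fst h0, weight] using Nat.pos_of_ne_zero
      (Nat.one_le_iff_ne_zero.1 (hr _))
  -- The largest index keeps every block of the monomial alive under `param`, and its size is
  -- exactly the exponent in 𝔮_j, so the two cases leave no gap.
  · obtain ⟨p, hp, hmax⟩ := (weight k r m).1.toFinset.exists_max_image (fun p => p.1)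
      ⟨q, Multiset.mem_toFinset.2 hq⟩
    rw [Multiset.mem_toFinset] at hp
    by_cases hlt : (weight k r m).2 < r p.1
    · exact Or.inr (sum_coeff_eq_zero (hfj p.1)
        (fun p' hp' => hmax p' (Multiset.mem_toFinset.2 hp')) hlt)
    · refine Or.inl (monomial_mem_of_weight c le_rfl hp ?_)
      rw [rowVar_of_le k r (not_lt.1 hlt)]
      exact Ideal.zero_mem _

end Blocks

end Eigenscheme

theorem mainTheorem2 {K : Type*} [Field K] (c : K) (l : ℕ) (hl : 1 ≤ l)
    (k r : Fin l → ℕ) (hk : ∀ i, 1 ≤ k i) (hr : ∀ i, 1 ≤ r i) (hanti : StrictAnti r) :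
    (Eigenscheme.minorIdeal (Eigenscheme.jordanMatrix c k r)
        = ⨅ j : Fin l, Eigenscheme.idealQ c k r j) ∧
      ∀ j : Fin l, (Eigenscheme.idealQ c k r j).IsPrimary ∧
        (Eigenscheme.idealQ c k r j).radical = Eigenscheme.idealH K k r j := by
  refine ⟨le_antisymm (le_iInf fun j => le_sup_left)
    (Eigenscheme.iInf_idealQ_le c hl hr hanti.antitone), fun j => ?_⟩
  have hj := Nat.one_le_iff_ne_zero.1 (hr j)
  rw [Eigenscheme.idealQ_eq_comap c hanti.antitone hj]
  refine ⟨(Eigenscheme.isPrimary_span_pow_of_prime Polynomial.prime_X hj).comap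
    (Eigenscheme.param k r K j).toRingHom, ?_⟩
  rw [← Ideal.comap_radical, Eigenscheme.radical_span_pow_of_prime Polynomial.prime_X hj,
    Eigenscheme.idealH_eq_comap]
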